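/- Let $\ell\ge 0$, $L=2^{\ell}$, and let $p$ be a prime (e.g. $\ell=32$, $p=37$). Parties $P_1,P_2,P_3$ (indices cyclic) hold values in 2-out-of-3 replicated sharings: for a modulus $m$ and $s\equiv s_1+s_2+s_3 \pmod m$, $P_j$ holds $(s_j,s_{j+1})$; a random sharing of $s$ is uniform among all $(s_1,s_2,s_3)$ with this sum. Residues modulo $m$ are represented in $\{0,\dots,m-1\}$. Put $\mathrm{wrap}_2(u,v,L)=0$ if $u+v<L$ and $1$ otherwise; $\mathrm{wrap}_{3e}(v_1,v_2,v_3,L)=\lfloor (v_1+v_2+v_3)/L\rfloor\in\{0,1,2\}$; $\mathrm{wrap}_3=\mathrm{wrap}_{3e}\bmod 2$. Ideal functionalities, each of which rejects (nobody gets an output) if a party submits no input or if the submitted pairs disagree on a share: $\mathcal F_{Mult}$ returns random shares of the product of two shared values; $\mathcal F_{Reconst}$ returns the shared value to all parties; $\mathcal F_{PC}$ takes shares modulo $p$ of bits $x[0],\dots,x[\ell-1]$ and a public integer $r$ (on which all parties must agree) and returns random shares modulo $2$ of the bit $(\sum_k x[k]2^k\ge r)$; $\mathcal F_{Prep}$ returns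 random shares $x_1,x_2,x_3$ modulo $L$ of a uniformly random $x$, random shares modulo $p$ of the bits of $x$, and random shares modulo $2$ of $\alpha=\mathrm{wrap}_3(x_1,x_2,x_3,L)$; $\mathcal F_{WA}$ takes shares $(a_1,a_2,a_3)$ modulo $L$ and returns random shares modulo $2$ of $\mathrm{wrap}_3(a_1,a_2,a_3,L)$. All are "with abort": the corrupted party gets its output first, and the adversary then decides which honest parties are denied theirs; such a party aborts. Protocol $\Pi_{WA}$, on shares of $a$ modulo $L$: (0) the parties obtain the correlated randomness from $\mathcal F_{Prep}$; (1) they locally compute $r_j\equiv a_j+x_j \pmod L$ and $\beta_j=\mathrm{wrap}_2(a_j,x_j,L)$; (2) they open $r\equiv r_1+r_2+r_3 \pmod L$ with $\mathcal F_{Reconst}$; (3) they compute $\delta=\mathrm{wrap}_3(r_1,r_2,r_3,L)$ in the clear; (4) they get shares of $\eta=(x\ge r+1)$ from $\mathcal F_{PC}$, applied to the bits of $x$ and the integer $r+1$; (5) they output their shares modulo $2$ of $\theta=\beta_1+\beta_2+\beta_3+\delta-\eta-\alpha$. Theorem. In the $(\mathcal F_{Mult},\mathcal F_{PC},\mathcal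 F_{Reconst},\mathcal F_{Prep})$-hybrid model, $\Pi_{WA}$ securely realizes $\mathcal F_{WA}$ with abort in the presence of one malicious party, perfectly and with a straight-line black-box simulator. That is, for each choice of the corrupted party there is a non-rewinding simulator, which interacts with the adversary in the place of the hybrid functionalities and with $\mathcal F_{WA}$ in the place of the corrupted party, such that for every (randomized) malicious adversary and all inputs of the honest parties, the joint distribution of the adversary's final state (which may contain its whole view) and of the outputs of the honest parties is the same in the execution of $\Pi_{WA}$ and in the ideal execution, in which the honest parties only hand their inputs to $\mathcal F_{WA}$. Moreover, for all $a_1,a_2,a_3,x_1,x_2,x_3\in\{0,\dots,L-1\}$, with $x\equiv x_1+x_2+x_3$, $r_j\equiv a_j+x_j$, $r\equiv r_1+r_2+r_3$ reduced modulo $L$ to $\{0,\dots,L-1\}$, $\theta_e=\mathrm{wrap}_{3e}(a_1,a_2,a_3,L)$, $\beta_j=\mathrm{wrap}_2(a_j,x_j,L)$, $\delta_e=\mathrm{wrap}_{3e}(r_1,r_2,r_3,L)$, $\alpha_e=\mathrm{wrap}_{3e}(x_1,x_2,x_3,L)$, and $\eta=1$ if $x\ge r+1$, $\eta=0$ otherwise,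 the following identity of integers holds: $$\theta_e=\beta_1+\beta_2+\beta_3+\delta_e-\eta-\alpha_e .$$ -/

import Mathlib

/-! ## Three-party functionalities with abort, hybrid protocols, simulation -/

/-- The three parties `P₁, P₂, P₃` are `0, 1, 2`; the next party of `j` is `j + 1`, cyclically. -/
abbrev Party := Fin 3

/-- A three-party ideal functionality for one session.  Every party submits an input; `eval` is the
joint law of the three outputs, where the outcome `none` means that the functionality rejects the
submitted inputs, in which case nobody receives an output. -/
structure Functionality where
  In : Type
  Out : Type
  eval : (Party → In) → PMF (Option (Party → Out))

/-- One session when some parties may refuse to submit an input (`none`): then nobody receives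
an output. -/
noncomputable def Functionality.run (G : Functionality) (q : Party → Option G.In) :
    PMF (Option (Party → G.Out)) :=
  if h : ∀ j, (q j).isSome then G.eval (fun j => (q j).get (h j)) else PMF.pure none

/-- Protocols for three parties whose only communication is through the ideal functionalities
`F c`, `c : ι` (the hybrid model).  `S` is the type of the local state of a party at the current
stage; it starts as the party's own input, and every output received from a functionality is
appended to it.  `Y` is the type of the outputs of the parties. -/
inductive HybridProtocol {ι : Type} (F : ι → Functionality) (Y : Type) : Type → Type 1 where
  /-- Every party computes its output from its local state. -/
  | ret {S : Type} (out : Party → S → Y) : HybridProtocol F Y S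
  /-- The parties call `F c`, with inputs computed from their local states. -/
  | call {S : Type} (c : ι) (input : Party → S → (F c).In)
      (rest : HybridProtocol F Y (S × (F c).Out)) : HybridProtocol F Y S

/-- A malicious adversary (together with the environment that it represents), with private state in
`σ` and private coins.  In every call it first chooses the input of the corrupted party (`none`:
refuse), then it sees the output of the corrupted party (`none`: no output), and then it decides
which of the honest parties are denied their output (`true`: the party aborts). -/
structure Adversary {ι : Type} (F : ι → Functionality) (σ : Type) where
  submit (c : ι) : σ → PMF (σ × Option (F c).In)
  receive (c : ι) : σ → Option (F c).Out → PMF (σ × (Party → Bool))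

/-- The execution of a protocol in the hybrid model with corrupted party `i`.  An honest party whose
state is `none` has aborted; it takes part in no further call and its output is `none`.
The result is the joint law of the final state of the adversary and the honest outputs. -/
noncomputable def hybridExec {ι : Type} {F : ι → Functionality} {Y σ : Type} (i : Party)
    (A : Adversary F σ) : {S : Type} → HybridProtocol F Y S → σ →
      ({j : Party // j ≠ i} → Option S) → PMF (σ × ({j : Party // j ≠ i} → Option Y))
  | _, .ret out, s, h => PMF.pure (s, fun j => (h j).map (out j))
  | _, .call c input rest, s, h => do
      let q ← A.submit c s
      let o ← (F c).run (fun j => if hj : j = i then q.2 else (h ⟨j, hj⟩).map (input j))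
      let d ← A.receive c q.1 (o.map fun y => y i)
      hybridExec i A rest d.1 (fun j =>
        if d.2 j then none else (h j).bind fun st => o.map fun y => (st, y j))

/-- A straight-line black-box simulator: a machine with private state in `τ` and private coins that
plays the functionalities `F c` towards an adversary, message by message and without rewinding,
while it has access to one session of the ideal functionality `G` in the role of the corrupted
party.  It is given neither the code nor the state of the adversary, and no inputs. -/
structure Simulator {ι : Type} (F : ι → Functionality) (G : Functionality) (τ : Type) where
  start : τ
  /-- Get the adversary's input to `F c`; possibly (`some`) submit an input to `G`, where
  `some none` is a refusal. -/
  consult (c : ι) : τ → Option (F c).In → PMF (τ × Option (Option G.In))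
  /-- Get what `G` has delivered to the corrupted party (`none` if `G` has not been called); answer
  the adversary in the name of `F c`. -/
  answer (c : ι) : τ → Option (Option G.Out) → PMF (τ × Option (F c).Out)
  /-- Get the adversary's decision which honest parties are denied the output of `F c`. -/
  observe (c : ι) : τ → (Party → Bool) → PMF τ
  /-- Decide which honest parties are denied the output of `G`. -/
  finish : τ → PMF (Party → Bool)

/-- The ideal execution: the honest parties hand their inputs `x` to `G` and output what they get
from it; the adversary talks to the simulator along the same sequence of calls.
`g` is `none` as long as `G` has not been called, and `some` of its outcome afterwards; only the
first submission counts.  If `G` is never called, the honest parties abort. -/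
noncomputable def idealExec {ι : Type} {F : ι → Functionality} {G : Functionality} {σ τ : Type}
    (i : Party) (A : Adversary F σ) (Sim : Simulator F G τ)
    (x : {j : Party // j ≠ i} → G.In) : {S : Type} → HybridProtocol F G.Out S → σ → τ →
      Option (Option (Party → G.Out)) → PMF (σ × ({j : Party // j ≠ i} → Option G.Out))
  | _, .ret _, s, t, g => do
      let d ← Sim.finish t
      PMF.pure (s, fun j => if d j then none else g.join.map fun y => y j)
  | _, .call c _ rest, s, t, g => do
      let q ← A.submit c s
      let e ← Sim.consult c t q.2
      let g' ← match g, e.2 with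
        | none, some z =>
            (G.run fun j => if hj : j = i then z else some (x ⟨j, hj⟩)).map some
        | g, _ => PMF.pure g
      let o ← Sim.answer c e.1 (g'.map fun r => r.map fun y => y i)
      let d ← A.receive c q.1 o.2
      let t' ← Sim.observe c o.1 d.2
      idealExec i A Sim x rest d.1 t' g'

/-- Perfect security with abort in the `F`-hybrid model in the presence of one malicious party, with
a straight-line black-box simulator: for every choice of the corrupted party there is a simulator
such that, for every adversary and all inputs of the honest parties, the joint laws of the
adversary's final state and of the honest outputs in the two executions are equal. -/
def SecurelyRealizesWithAbort {ι : Type} (F : ι → Functionality) (G : Functionality)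
    (P : HybridProtocol F G.Out G.In) : Prop :=
  ∀ i : Party, ∃ (τ : Type) (Sim : Simulator F G τ),
    ∀ (σ : Type) (A : Adversary F σ) (s : σ) (x : {j : Party // j ≠ i} → G.In),
      hybridExec i A P s (fun j => some (x j)) = idealExec i A Sim x P s Sim.start none

/-! ## Replicated secret sharing -/

/-- What one party holds of a 2-out-of-3 replicated sharing over `R`: party `j` holds the shares
number `j` and `j + 1`. -/
abbrev RShare (R : Type) := R × R

/-- Hand out a sharing to the parties. -/
def deal {R : Type} (v : Party → R) (j : Party) : RShare R := (v j, v (j + 1))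

/-- The sharing described by the pairs of the three parties, if they agree on all three shares. -/
def collect {R : Type} [DecidableEq R] (w : Party → RShare R) : Option (Party → R) :=
  if ∀ j, (w j).2 = (w (j + 1)).1 then some (fun j => (w j).1) else none

theorem sharings_nonempty {R : Type} [AddCommGroup R] [Fintype R] [DecidableEq R] (s : R) :
    (Finset.univ.filter fun v : Party → R => ∑ j, v j = s).Nonempty :=
  ⟨![s, 0, 0], by simp [Fin.sum_univ_three]⟩

/-- A uniformly random sharing of `s`. -/
noncomputable def randomShares {R : Type} [AddCommGroup R] [Fintype R] [DecidableEq R] (s : R) :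
    PMF (Party → R) :=
  PMF.uniformOfFinset (Finset.univ.filter fun v : Party → R => ∑ j, v j = s) (sharings_nonempty s)

/-! ## Wrap functions -/

/-- `wrap₂(u, v, m)`, for residues represented in `{0, …, m - 1}`. -/
def wrap2 {m : ℕ} (u v : ZMod m) : ℕ := if u.val + v.val < m then 0 else 1

/-- The exact wrap function `wrap₃ₑ(v₁, v₂, v₃, m)`. -/
def wrap3e {m : ℕ} (v : Party → ZMod m) : ℕ :=
  if ∑ j, (v j).val < m then 0 else if ∑ j, (v j).val < 2 * m then 1 else 2

/-- `wrap₃`, the exact wrap function modulo 2. -/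
def wrap3 {m : ℕ} (v : Party → ZMod m) : ZMod 2 := (wrap3e v : ZMod 2)

/-! ## The functionalities -/

/-- Multiplication of two shared values modulo `m`, with fresh random shares of the product. -/
noncomputable def functMult (m : ℕ) [NeZero m] : Functionality where
  In := RShare (ZMod m) × RShare (ZMod m)
  Out := RShare (ZMod m)
  eval w := match collect (fun j => (w j).1), collect (fun j => (w j).2) with
    | some u, some v => do
        let z ← randomShares ((∑ j, u j) * ∑ j, v j)
        PMF.pure (some (deal z))
    | _, _ => PMF.pure none

/-- Opening of a shared value modulo `m` to all parties. -/
noncomputable def functReconst (m : ℕ) : Functionality where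
  In := RShare (ZMod m)
  Out := ZMod m
  eval w := match collect w with
    | some v => PMF.pure (some fun _ => ∑ j, v j)
    | none => PMF.pure none

/-- Private comparison: from shares modulo `p` of `ℓ` bits of `x` and a public integer `r`, on which
the parties have to agree, to fresh random shares modulo 2 of the bit `x ≥ r`. -/
noncomputable def functPC (ℓ p : ℕ) : Functionality where
  In := RShare (Fin ℓ → ZMod p) × ℕ
  Out := RShare (ZMod 2)
  eval w := match collect (fun j => (w j).1) with
    | some v =>
        if ∀ j, (w j).2 = (w 0).2 then do
          let x := ∑ k : Fin ℓ, (∑ j, v j k).val * 2 ^ (k : ℕ)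
          let z ← randomShares (if x ≥ (w 0).2 then (1 : ZMod 2) else 0)
          PMF.pure (some (deal z))
        else PMF.pure none
    | none => PMF.pure none

/-- The bits of `x`, as elements of `ZMod p`. -/
def bitsOf (ℓ p : ℕ) (x : ZMod (2 ^ ℓ)) : Fin ℓ → ZMod p :=
  fun k => if x.val.testBit k then 1 else 0

/-- Correlated randomness for `wrap₃`: random shares of a uniformly random `x` modulo `2 ^ ℓ`, random
shares modulo `p` of the bits of `x`, and random shares modulo 2 of `wrap₃` of the shares of `x`. -/
noncomputable def functPrep (ℓ p : ℕ) [NeZero p] : Functionality where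
  In := Unit
  Out := RShare (ZMod (2 ^ ℓ)) × RShare (Fin ℓ → ZMod p) × RShare (ZMod 2)
  eval _ := do
    let x ← PMF.uniformOfFintype (ZMod (2 ^ ℓ))
    let xs ← randomShares x
    let bs ← randomShares (bitsOf ℓ p x)
    let αs ← randomShares (wrap3 xs)
    PMF.pure (some fun j => (deal xs j, deal bs j, deal αs j))

/-- The wrap functionality: fresh random shares modulo 2 of `wrap₃` of the given shares. -/
noncomputable def functWA (m : ℕ) : Functionality where
  In := RShare (ZMod m)
  Out := RShare (ZMod 2)
  eval w := match collect w with
    | some a => do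
        let z ← randomShares (wrap3 a)
        PMF.pure (some (deal z))
    | none => PMF.pure none

/-- Names of the functionalities of the hybrid model. -/
inductive WrapHybridIndex : Type where
  | mult (m : ℕ) [NeZero m]
  | pc
  | reconst (m : ℕ)
  | prep

/-- The (Mult, PC, Reconst, Prep)-hybrid model. -/
noncomputable def wrapHybrid (ℓ p : ℕ) [NeZero p] : WrapHybridIndex → Functionality
  | @WrapHybridIndex.mult m _ => functMult m
  | .pc => functPC ℓ p
  | .reconst m => functReconst m
  | .prep => functPrep ℓ p

/-! ## The wrap protocol -/

/-- Party `j` with its pair `u` of shares of a value adds a public constant `c` to the shared value: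
share number `0` absorbs the constant. -/
def addPublic {R : Type} [AddCommGroup R] (j : Party) (c : R) (u : RShare R) : RShare R :=
  (if j = 0 then u.1 + c else u.1, if j + 1 = 0 then u.2 + c else u.2)

/-- The last step of party `j`, from its shares `a`, its correlated randomness `x`, `α`, the
opened value `r` and its shares `η`: the party knows two of the shares `r_j = a_j + x_j` of `r`,
computes the third one from `r`, and hence `δ = wrap₃(r₁, r₂, r₃)` in the clear. -/
def wrapOutput {m : ℕ} (j : Party) (a x : RShare (ZMod m)) (α : RShare (ZMod 2)) (r : ZMod m)
    (η : RShare (ZMod 2)) : RShare (ZMod 2) :=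
  let β : RShare (ZMod 2) := ((wrap2 a.1 x.1 : ZMod 2), (wrap2 a.2 x.2 : ZMod 2))
  let δ : ZMod 2 := wrap3 ![a.1 + x.1, a.2 + x.2, r - (a.1 + x.1) - (a.2 + x.2)]
  addPublic j δ (β - η - α)

/-- The wrap protocol: get the correlated randomness; open `r = ∑ (a_j + x_j)`; compare `x` with
the integer `r + 1` (which may be equal to `2 ^ ℓ`); output the shares of
`β₁ + β₂ + β₃ + δ - η - α`. -/
noncomputable def protocolWA (ℓ p : ℕ) [NeZero p] :
    HybridProtocol (wrapHybrid ℓ p) (functWA (2 ^ ℓ)).Out (functWA (2 ^ ℓ)).In :=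
  .call .prep (fun _ _ => ()) <|
  .call (.reconst (2 ^ ℓ))
    (fun _ (a, (x, _, _)) =>
      ((a.1 + x.1, a.2 + x.2) : ZMod (2 ^ ℓ) × ZMod (2 ^ ℓ))) <|
  .call .pc
    (fun _ ((_, (_, b, _)), r) => (b, ZMod.val (n := 2 ^ ℓ) r + 1)) <|
  .ret (fun j (((a, (x, _, α)), r), η) => wrapOutput (m := 2 ^ ℓ) j a x α r η)

/-! The integer identity counts carries. With representatives in `{0, …, L - 1}`, every sum modulo
`L` equals the integer sum minus `L` times a wrap count. The representative of `r` is computed in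
two ways, from the masked shares `a_j + x_j` and from the reduced sums of the `a_j` and of the
`x_j`. Comparing the two and cancelling `L` gives the identity, because the carry of the reduced
sums is the comparison bit: a carry occurs exactly when `r` drops below `x`.

For security, fix the corrupted party `i`. A sharing of `s` is freely parametrized by the pair that
`i` holds (`randomShares_eq_map`), so every pair handed to `i` is uniform and independent of the
secret. Given its correlated randomness, the mask `x` is still uniform, hence so is the opened `r`.
Each share that `i` holds is also held by an honest party, so any deviation in a submitted pair is
rejected (`collect_replace_deal`). The simulator therefore hands out a random pair, extracts the
input of `i` from the opening, submits it to the wrap functionality, and opens a random `r`.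

For fixed `r` the last step of `i` is an involution in its comparison share
(`wrapOutput_wrapOutput`). Applying it to the prescribed output `z` gives a uniform comparison share
that leads to `z`, and by `wrapOutput_sharingOf` the honest outputs are then the matching ones. A
denied output before the last call makes the next call fail for everybody, so only denials in the
comparison are passed on selectively.

The two executions are compared call by call: the responses have the same view law, and the hidden
data is tracked conditionally on the view (`IndistinguishableStep`). -/

/-! ### Carry arithmetic and bits. -/

theorem val_add_eq_sub_wrap2 {m : ℕ} [NeZero m] (u v : ZMod m) :
    ((u + v).val : ℤ) = u.val + v.val - m * wrap2 u v := by
  have hu := ZMod.val_lt u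
  have hv := ZMod.val_lt v
  rw [wrap2]
  split_ifs with h
  · rw [ZMod.val_add_of_lt h]; simp
  · have := ZMod.val_add_val_of_le (not_lt.mp h)
    push_cast
    omega

theorem val_sum_eq_sub_wrap3e {m : ℕ} [NeZero m] (v : Party → ZMod m) :
    ((∑ j, v j).val : ℤ) = ∑ j, ((v j).val : ℤ) - m * wrap3e v := by
  have h0 := ZMod.val_lt (v 0)
  have h1 := ZMod.val_lt (v 1)
  have h2 := ZMod.val_lt (v 2)
  simp only [wrap3e, Fin.sum_univ_three, val_add_eq_sub_wrap2, wrap2]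
  have h01 := val_add_eq_sub_wrap2 (v 0) (v 1)
  rw [wrap2] at h01
  split_ifs at h01 ⊢ <;> push_cast at h01 ⊢ <;> omega

/-- The wrap identity: the wrap count of a sharing, from those of its masking. -/
theorem wrap3e_eq_of_mask {m : ℕ} [NeZero m] (a x : Party → ZMod m) :
    (wrap3e a : ℤ) =
      (wrap2 (a 0) (x 0) : ℤ) + (wrap2 (a 1) (x 1) : ℤ) + (wrap2 (a 2) (x 2) : ℤ)
        + (wrap3e (fun j => a j + x j) : ℤ)
        - (if (∑ j, x j).val ≥ (∑ j, (a j + x j)).val + 1 then (1 : ℤ) else 0)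
        - (wrap3e x : ℤ) := by
  have hm : (m : ℤ) ≠ 0 := by exact_mod_cast NeZero.ne m
  have hA := val_sum_eq_sub_wrap3e a
  have hX := val_sum_eq_sub_wrap3e x
  have hR := val_sum_eq_sub_wrap3e (fun j => a j + x j)
  have hr := val_add_eq_sub_wrap2 (∑ j, a j) (∑ j, x j)
  -- Without a carry the sum is at least `x`; with a carry it is `x` minus the positive number `m -
  -- a`, so it is strictly below `x`.
  have hη : (if (∑ j, x j).val ≥ (∑ j, (a j + x j)).val + 1 then (1 : ℤ) else 0)
      = wrap2 (∑ j, a j) (∑ j, x j) := by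
    have := ZMod.val_lt (∑ j, a j)
    rw [Finset.sum_add_distrib]
    rw [wrap2] at hr ⊢
    split_ifs at hr ⊢ <;> push_cast at hr ⊢ <;> omega
  rw [hη]
  rw [← Finset.sum_add_distrib] at hr
  simp only [Fin.sum_univ_three (f := fun j => ((a j).val : ℤ)),
    Fin.sum_univ_three (f := fun j => ((x j).val : ℤ))] at hA hX
  rw [Fin.sum_univ_three (f := fun j => ((a j + x j).val : ℤ))] at hR
  simp only [val_add_eq_sub_wrap2 (a _) (x _)] at hR
  apply mul_left_cancel₀ hm
  linear_combination hX + hA - hR + hr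

theorem wrap3_eq_of_mask {m : ℕ} [NeZero m] (a x : Party → ZMod m) :
    wrap3 a = (∑ j, (wrap2 (a j) (x j) : ZMod 2)) + wrap3 (fun j => a j + x j)
      - (if (∑ j, x j).val ≥ (∑ j, (a j + x j)).val + 1 then (1 : ZMod 2) else 0) - wrap3 x := by
  have h := congrArg (Int.cast (R := ZMod 2)) (wrap3e_eq_of_mask a x)
  push_cast at h
  simpa only [wrap3, Fin.sum_univ_three] using h

theorem testBit_sum (ℓ n : ℕ) (hn : n < 2 ^ ℓ) :
    ∑ k : Fin ℓ, (if n.testBit k then 1 else 0) * 2 ^ (k : ℕ) = n := by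
  induction ℓ generalizing n with
  | zero => simp at hn; simp [hn]
  | succ ℓ ih =>
    rw [Fin.sum_univ_succ]
    have := ih (n / 2) (by omega)
    simp only [Fin.val_zero, pow_zero, Fin.val_succ, Nat.testBit_succ, pow_succ, ← mul_assoc,
      ← Finset.sum_mul, this]
    simp only [Nat.testBit_zero, decide_eq_true_eq]
    split_ifs <;> omega

theorem sum_val_bitsOf (ℓ p : ℕ) [Fact p.Prime] (x : ZMod (2 ^ ℓ)) :
    ∑ k : Fin ℓ, (bitsOf ℓ p x k).val * 2 ^ (k : ℕ) = x.val := by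
  -- For `1 < p` the residue `1` is represented by the integer 1.
  have : Fact (1 < p) := ⟨(Fact.out : p.Prime).one_lt⟩
  rw [← testBit_sum ℓ x.val (ZMod.val_lt x)]
  refine Finset.sum_congr rfl fun k _ => ?_
  rw [bitsOf]
  split_ifs <;> simp [ZMod.val_one]

/-! ### Uniform laws and replicated sharings. -/

theorem map_uniformOfFintype {α β : Type} [Fintype α] [Nonempty α] [DecidableEq β] (f : α → β)
    (hf : f.Injective) (s : Finset β) (hs : s.Nonempty) (h : Finset.univ.image f = s) :
    (PMF.uniformOfFintype α).map f = PMF.uniformOfFinset s hs := by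
  subst h
  ext b
  rw [PMF.map_apply, PMF.uniformOfFinset_apply, Finset.card_image_of_injective _ hf]
  split_ifs with hb
  · obtain ⟨a, -, rfl⟩ := Finset.mem_image.mp hb
    rw [tsum_eq_single a]
    · simp
    · intro a' ha'
      rw [if_neg fun h => ha' (hf h).symm]
  · refine ENNReal.tsum_eq_zero.mpr fun a => ?_
    rw [if_neg]
    rintro rfl
    exact hb (by simp)

theorem bind_uniformOfFintype_equiv {α β : Type} [Fintype α] [Nonempty α] (e : α ≃ α)
    (f : α → PMF β) :
    ((PMF.uniformOfFintype α).bind fun a => f (e a)) = (PMF.uniformOfFintype α).bind f := by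
  classical
  have h : (PMF.uniformOfFintype α).map e = PMF.uniformOfFintype α :=
    map_uniformOfFintype e e.injective _ _ (by simp)
  conv_rhs => rw [← h, PMF.bind_map]
  rfl

theorem sum_eq_sum_rotate {R : Type} [AddCommMonoid R] (i : Party) (v : Party → R) :
    ∑ j, v j = v i + v (i + 1) + v (i + 2) := by
  rw [← Equiv.sum_comp (Equiv.addLeft i) v, Fin.sum_univ_three]
  simp

theorem collect_deal {R : Type} [DecidableEq R] (v : Party → R) : collect (deal v) = some v := by
  simp [collect, deal]

theorem eq_deal_of_collect {R : Type} [DecidableEq R] {w : Party → RShare R} {v : Party → R} (h : collect w = some v) :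
    w = deal v := by
  rw [collect] at h
  split_ifs at h with hw
  cases h
  funext j
  exact Prod.ext rfl (hw j)

/-- Party `i + 2` also holds share `i`, and party `i + 1` also holds share `i + 1`; the two honest
parties thus pin down the whole pair of party `i`. -/
theorem collect_replace_deal {R : Type} [DecidableEq R] (i : Party) (v : Party → R) (u : RShare R) :
    collect (fun j => if j = i then u else deal v j) = if u = deal v i then some v else none := by
  split_ifs with h
  · subst h
    rw [← collect_deal v]
    congr 1
    funext j
    split_ifs with hj
    · rw [hj]
    · rfl
  · rw [Option.eq_none_iff_forall_ne_some]
    intro v' hv'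
    have hw := eq_deal_of_collect hv'
    have h0 := congrFun hw i
    have h1 := congrFun hw (i + 1)
    have h2 := congrFun hw (i + 2)
    simp only [deal, if_pos, Prod.ext_iff, add_eq_left, Fin.isValue, one_ne_zero, if_false,
      Fin.reduceEq, add_assoc] at h0 h1 h2 h
    simp only [show (1 : Party) + 1 = 2 from rfl, show (2 : Party) + 1 = 0 from rfl, add_zero]
      at h0 h1 h2 h
    exact h ⟨h0.1.trans h2.2.symm, h0.2.trans h1.1.symm⟩

/-- The sharing of `s` in which the shares number `i` and `i + 1` are given. -/
def sharingOf {R : Type} [AddCommGroup R] (i : Party) (u : RShare R) (s : R) (j : Party) : R :=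
  if j = i then u.1 else if j = i + 1 then u.2 else s - u.1 - u.2

section sharing
variable {R : Type} [AddCommGroup R]

theorem sum_sharingOf (i : Party) (u : RShare R) (s : R) : ∑ j, sharingOf i u s j = s := by
  rw [sum_eq_sum_rotate i]
  simp [sharingOf]

theorem deal_sharingOf (i : Party) (u : RShare R) (s : R) : deal (sharingOf i u s) i = u := by
  simp [deal, sharingOf]

theorem sharingOf_deal (i : Party) (v : Party → R) : sharingOf i (deal v i) (∑ j, v j) = v := by
  funext j
  rw [sum_eq_sum_rotate i]
  fin_cases i <;> fin_cases j <;> simp [sharingOf, deal] <;> first | rfl | abel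

variable [DecidableEq R]

/-- Masking by a consistent sharing does not change consistency. Hence the opening is rejected
exactly when the wrap functionality rejects the unmasked pairs. -/
theorem collect_add_deal (w : Party → RShare R) (x : Party → R) :
    collect (fun j => w j + deal x j) = (collect w).map (fun v j => v j + x j) := by
  by_cases h : ∀ j, (w j).2 = (w (j + 1)).1
  · rw [collect, if_pos (by intro j; simp [deal, h j]), collect, if_pos h]; rfl
  · rw [collect, if_neg (by intro h'; apply h; intro j; simpa [deal] using h' j), collect,
      if_neg h]; rfl

variable [Fintype R]

/-- The pair of party `i` is arbitrary and determines the third share through the sum. This makes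
the view of party `i` independent of `s`. -/
theorem randomShares_eq_map (i : Party) (s : R) :
    randomShares s = (PMF.uniformOfFintype (RShare R)).map fun u => sharingOf i u s := by
  symm
  apply map_uniformOfFintype
  · intro u u' h
    simpa only [deal_sharingOf] using congrArg (deal · i) h
  · ext v
    simp only [Finset.mem_image, Finset.mem_univ, true_and, Finset.mem_filter]
    constructor
    · rintro ⟨u, rfl⟩
      exact sum_sharingOf i u s
    · rintro rfl
      exact ⟨deal v i, sharingOf_deal i v⟩

end sharing

/-! ### The last step of the protocol. -/

theorem wrap3_rotate {m : ℕ} [NeZero m] (j : Party) (v : Party → ZMod m) :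
    wrap3 ![v j, v (j + 1), v (j + 2)] = wrap3 v := by
  have h : ∑ k, (![v j, v (j + 1), v (j + 2)] k).val = ∑ k, (v k).val := by
    rw [sum_eq_sum_rotate j fun k => (v k).val, Fin.sum_univ_three]
    rfl
  rw [wrap3, wrap3, wrap3e, wrap3e, h]

/-- On the opened value, the last step is an involution in the shares of the comparison bit. -/
theorem wrapOutput_wrapOutput {m : ℕ} (j : Party) (a x : RShare (ZMod m)) (α : RShare (ZMod 2))
    (r : ZMod m) (z : RShare (ZMod 2)) :
    wrapOutput j a x α r (wrapOutput j a x α r z) = z := by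
  simp only [wrapOutput, addPublic]
  ext <;> dsimp <;> split_ifs <;> ring

/-- Each party recovers the third masked share by subtraction from `r`, so all see the same `δ` up
to rotation of its arguments, and their output pairs belong to one sharing. -/
theorem wrapOutput_deal {m : ℕ} [NeZero m] (j : Party) (a x : Party → ZMod m)
    (α η : Party → ZMod 2) :
    wrapOutput j (deal a j) (deal x j) (deal α j) (∑ k, (a k + x k)) (deal η j) =
      deal (fun k => (if k = 0 then wrap3 (fun k => a k + x k) else 0) + wrap2 (a k) (x k)
        - η k - α k) j := by
  have h := wrap3_rotate j (fun k => a k + x k)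
  have hr : ∑ k, (a k + x k) - (a j + x j) - (a (j + 1) + x (j + 1)) = a (j + 2) + x (j + 2) := by
    rw [sum_eq_sum_rotate j]; ring
  simp only [wrapOutput, addPublic, deal, hr, h]
  ext <;> dsimp <;> split_ifs <;> ring

/-- Correctness: from shares of the comparison bit which the last step of party `i` turns into `z`,
all parties obtain the sharing of the wrap bit in which party `i` holds `z`. -/
theorem wrapOutput_sharingOf {m : ℕ} [NeZero m] (i j : Party) (a x : Party → ZMod m)
    (α : Party → ZMod 2) (hα : ∑ k, α k = wrap3 x) (z : RShare (ZMod 2)) (r : ZMod m)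
    (hr : r = ∑ k, (a k + x k)) :
    wrapOutput j (deal a j) (deal x j) (deal α j) r
      (deal (sharingOf i (wrapOutput i (deal a i) (deal x i) (deal α i) r z)
        (if (∑ k, x k).val ≥ r.val + 1 then 1 else 0)) j) =
      deal (sharingOf i z (wrap3 a)) j := by
  subst hr
  set η := sharingOf i (wrapOutput i (deal a i) (deal x i) (deal α i) (∑ k, (a k + x k)) z)
    (if (∑ k, x k).val ≥ (∑ k, (a k + x k)).val + 1 then 1 else 0) with hη
  rw [wrapOutput_deal]
  congr 1
  -- A sharing is determined by the pair of party `i` and the sum: the pair is handled by the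
  -- involution, the sum by the wrap identity modulo 2.
  rw [← sharingOf_deal i (fun k => _ - _)]
  congr 1
  · rw [← wrapOutput_deal, hη, deal_sharingOf, wrapOutput_wrapOutput]
  · rw [wrap3_eq_of_mask a x, ← hα]
    simp only [Finset.sum_sub_distrib, Finset.sum_add_distrib]
    rw [hη, sum_sharingOf]
    simp only [Finset.sum_add_distrib]
    simp
    ring

/-! ### Executions, aborts and dead simulators. -/

theorem Functionality.run_eq_pure_none (G : Functionality) (q : Party → Option G.In) (j : Party)
    (hj : q j = none) : G.run q = PMF.pure none := by
  rw [Functionality.run, dif_neg]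
  intro h
  simpa [hj] using h j

theorem Functionality.run_some (G : Functionality) (w : Party → G.In) :
    (G.run fun j => some (w j)) = G.eval w := by
  rw [Functionality.run, dif_pos (fun _ => by rfl)]
  rfl

theorem hybridExec_call {ι : Type} {F : ι → Functionality} {Y σ : Type} {i : Party}
    (A : Adversary F σ) {S : Type} (c : ι) (input : Party → S → (F c).In)
    (rest : HybridProtocol F Y (S × (F c).Out)) (s : σ) (h : {j : Party // j ≠ i} → Option S) :
    hybridExec i A (.call c input rest) s h =
      (A.submit c s).bind fun q =>
        ((F c).run fun j => if hj : j = i then q.2 else (h ⟨j, hj⟩).map (input j)).bind fun o =>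
          (A.receive c q.1 (o.map fun y => y i)).bind fun d =>
            hybridExec i A rest d.1 fun j =>
              if d.2 j then none else (h j).bind fun st => o.map fun y => (st, y j) := by
  rw [hybridExec]
  rfl

/-- An aborted party submits nothing, so the call produces no output and the other honest party
aborts as well. -/
theorem hybridExec_of_aborted {ι : Type} {F : ι → Functionality} {Y σ : Type} {i : Party}
    (A : Adversary F σ) {S : Type} (c : ι) (input : Party → S → (F c).In)
    (rest : HybridProtocol F Y (S × (F c).Out)) (s : σ) (h : {j : Party // j ≠ i} → Option S)
    (j : {j : Party // j ≠ i}) (hj : h j = none) :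
    hybridExec i A (.call c input rest) s h =
      (A.submit c s).bind fun q => (A.receive c q.1 none).bind fun d =>
        hybridExec i A rest d.1 fun _ => none := by
  rw [hybridExec_call]
  congr 1
  funext q
  rw [Functionality.run_eq_pure_none _ _ j (by simp [j.2, hj]), PMF.pure_bind]
  simp

theorem hybridExec_call_eq_none {ι : Type} {F : ι → Functionality} {Y σ : Type} {i : Party}
    (A : Adversary F σ) {S : Type} (c : ι) (input : Party → S → (F c).In)
    (rest : HybridProtocol F Y (S × (F c).Out)) (s : σ) (h : {j : Party // j ≠ i} → Option S)
    (j : {j : Party // j ≠ i}) (hj : h j = none) :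
    hybridExec i A (.call c input rest) s h =
      hybridExec i A (.call c input rest) s fun _ => none := by
  rw [hybridExec_of_aborted A c input rest s h j hj,
    hybridExec_of_aborted A c input rest s _ j rfl]

/-- The outcome of the session of `G` in the ideal execution after a possible submission `e`. -/
noncomputable def sessionOutcome {G : Functionality} {i : Party} (x : {j : Party // j ≠ i} → G.In) :
    Option (Option (Party → G.Out)) → Option (Option G.In) → PMF (Option (Option (Party → G.Out)))
  | none, some z => (G.run fun j => if hj : j = i then z else some (x ⟨j, hj⟩)).map some
  | g, _ => PMF.pure g

theorem sessionOutcome_none {G : Functionality} {i : Party} (x : {j : Party // j ≠ i} → G.In)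
    (g : Option (Option (Party → G.Out))) : sessionOutcome x g none = PMF.pure g := by
  cases g <;> rfl

theorem idealExec_call {ι : Type} {F : ι → Functionality} {G : Functionality} {σ τ : Type}
    {i : Party} (A : Adversary F σ) (Sim : Simulator F G τ) (x : {j : Party // j ≠ i} → G.In)
    {S : Type} (c : ι) (input : Party → S → (F c).In)
    (rest : HybridProtocol F G.Out (S × (F c).Out)) (s : σ) (t : τ)
    (g : Option (Option (Party → G.Out))) :
    idealExec i A Sim x (.call c input rest) s t g =
      (A.submit c s).bind fun q => (Sim.consult c t q.2).bind fun e =>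
        (sessionOutcome x g e.2).bind fun g' =>
          (Sim.answer c e.1 (g'.map fun r => r.map fun y => y i)).bind fun o =>
            (A.receive c q.1 o.2).bind fun d => (Sim.observe c o.1 d.2).bind fun t' =>
              idealExec i A Sim x rest d.1 t' g' := by
  rw [idealExec]
  change PMF.bind _ _ = _
  congr 1
  funext q
  change PMF.bind _ _ = _
  congr 1
  funext ⟨t', e⟩
  cases g <;> cases e <;> rfl

/-- A state in which a simulator lets every call fail, and in the end denies all outputs. -/
structure Simulator.IsDead {ι : Type} {F : ι → Functionality} {G : Functionality} {τ : Type}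
    (Sim : Simulator F G τ) (t : τ) : Prop where
  consult (c : ι) (q : Option (F c).In) : Sim.consult c t q = PMF.pure (t, none)
  answer (c : ι) (o : Option (Option G.Out)) : Sim.answer c t o = PMF.pure (t, none)
  observe (c : ι) (d : Party → Bool) : Sim.observe c t d = PMF.pure t
  finish : Sim.finish t = PMF.pure fun _ => true

theorem idealExec_of_isDead {ι : Type} {F : ι → Functionality} {G : Functionality} {σ τ : Type}
    {i : Party} (A : Adversary F σ) {Sim : Simulator F G τ} {t : τ} (ht : Sim.IsDead t)
    (x : {j : Party // j ≠ i} → G.In) {S : Type} (P : HybridProtocol F G.Out S) (s : σ)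
    (g : Option (Option (Party → G.Out))) :
    idealExec i A Sim x P s t g = hybridExec i A P s fun _ => none := by
  induction P generalizing s with
  | ret out =>
    rw [idealExec, hybridExec, ht.finish]
    change PMF.bind _ _ = _
    rw [PMF.pure_bind]
    rfl
  | call c input rest ih =>
    have hi : i + 1 ≠ i := by simp
    rw [hybridExec_of_aborted A c input rest s _ ⟨i + 1, hi⟩ rfl, idealExec_call]
    simp only [ht.consult, ht.answer, ht.observe, PMF.pure_bind, sessionOutcome_none, ih]

/-! ### The simulator and the stages of the protocol. -/

/-- What a party receives from the correlated randomness functionality. -/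
abbrev PrepShare (ℓ p : ℕ) : Type :=
  RShare (ZMod (2 ^ ℓ)) × RShare (Fin ℓ → ZMod p) × RShare (ZMod 2)

/-- The states of the simulator for the wrap protocol. -/
inductive WrapSimState (ℓ p : ℕ) : Type where
  /-- Nothing has happened yet. -/
  | start
  /-- The correlated randomness has been requested. -/
  | requested
  /-- The correlated randomness has been handed out. -/
  | prepared (v : PrepShare ℓ p)
  /-- The adversary has submitted shares for the opening, from which its input `a` is extracted. -/
  | opening (v : PrepShare ℓ p) (a : RShare (ZMod (2 ^ ℓ)))
  /-- The value `r` has been opened; the output of the corrupted party will be `z`. -/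
  | opened (v : PrepShare ℓ p) (a : RShare (ZMod (2 ^ ℓ))) (r : ZMod (2 ^ ℓ)) (z : RShare (ZMod 2))
  /-- The comparison is carried out, with result `η` for the corrupted party. -/
  | comparing (η : RShare (ZMod 2))
  /-- The comparison is over, and `d` are the parties that have been denied its result. -/
  | compared (d : Party → Bool)
  /-- The execution has failed for all honest parties. -/
  | dead

open Classical in
/-- The simulator for the wrap protocol with corrupted party `i`. -/
noncomputable def wrapSimulator (ℓ p : ℕ) [NeZero p] (i : Party) :
    Simulator (wrapHybrid ℓ p) (functWA (2 ^ ℓ)) (WrapSimState ℓ p) where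
  start := .start
  consult c t q := match c, t, q with
    | .prep, .start, some _ => PMF.pure (.requested, none)
    | .reconst _, .prepared v, some w =>
        -- The pattern leaves the modulus of the opening arbitrary; for `2 ^ ℓ`, the one that
        -- occurs, the casts are identities.
        let a : RShare (ZMod (2 ^ ℓ)) := (ZMod.cast w.1 - v.1.1, ZMod.cast w.2 - v.1.2)
        PMF.pure (.opening v a, some (some a))
    | .pc, .opened v a r z, some w =>
        if w = (v.2.1, r.val + 1) then PMF.pure (.comparing (wrapOutput i a v.1 v.2.2 r z), none)
        else PMF.pure (.dead, none)
    | _, _, _ => PMF.pure (.dead, none)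
  answer c t o := match c, t, o with
    | .prep, .requested, _ =>
        (PMF.uniformOfFintype (PrepShare ℓ p)).map fun v => (.prepared v, some v)
    | .reconst m, .opening v a, some (some z) =>
        (PMF.uniformOfFintype (ZMod (2 ^ ℓ))).map fun r => (.opened v a r z, some (ZMod.cast r : ZMod m))
    | .pc, .comparing η, _ => PMF.pure (.comparing η, some η)
    | _, _, _ => PMF.pure (.dead, none)
  observe _ t d := match t with
    | .comparing _ => PMF.pure (.compared d)
    -- Another call follows here, and it fails once an honest party has been denied its output.
    | t => PMF.pure (if ∃ j, j ≠ i ∧ d j = true then .dead else t)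
  finish t := match t with
    | .compared d => PMF.pure d
    | _ => PMF.pure fun _ => true

theorem wrapSimulator_isDead (ℓ p : ℕ) [NeZero p] (i : Party) :
    (wrapSimulator ℓ p i).IsDead .dead where
  consult c q := by cases c <;> rfl
  answer c o := by cases c <;> rfl
  observe c d := by simp [wrapSimulator]
  finish := rfl

/-- The part of the wrap protocol that follows the opening of `r`. -/
noncomputable def comparisonStage (ℓ p : ℕ) [NeZero p] :
    HybridProtocol (wrapHybrid ℓ p) (functWA (2 ^ ℓ)).Out
      ((RShare (ZMod (2 ^ ℓ)) × PrepShare ℓ p) × ZMod (2 ^ ℓ)) :=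
  .call .pc
    (fun _ s => (s.1.2.2.1, s.2.val + 1)) <|
  .ret (fun j s => wrapOutput (m := 2 ^ ℓ) j s.1.1.1 s.1.1.2.1 s.1.1.2.2.2 s.1.2 s.2)

/-- The part of the wrap protocol that follows the distribution of the correlated randomness. -/
noncomputable def openingStage (ℓ p : ℕ) [NeZero p] :
    HybridProtocol (wrapHybrid ℓ p) (functWA (2 ^ ℓ)).Out
      (RShare (ZMod (2 ^ ℓ)) × PrepShare ℓ p) :=
  .call (.reconst (2 ^ ℓ)) (fun _ s => s.1 + s.2.1) (comparisonStage ℓ p)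

theorem protocolWA_eq (ℓ p : ℕ) [NeZero p] :
    protocolWA ℓ p = .call .prep (fun _ _ => ()) (openingStage ℓ p) := rfl

/-! ### The functionalities in terms of the pair of the corrupted party. -/

theorem functPC_eval (ℓ p : ℕ) [Fact p.Prime] (i : Party) (x : ZMod (2 ^ ℓ))
    (b : Party → Fin ℓ → ZMod p) (hb : ∑ j, b j = bitsOf ℓ p x) (n : ℕ)
    (w : RShare (Fin ℓ → ZMod p) × ℕ) :
    (functPC ℓ p).eval (fun j => if j = i then w else (deal b j, n)) =
      if w = (deal b i, n) then
        (PMF.uniformOfFintype (RShare (ZMod 2))).map fun u =>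
          some (deal (sharingOf i u (if x.val ≥ n then 1 else 0)))
      else PMF.pure none := by
  have hcollect : collect (fun j => (if j = i then w else (deal b j, n)).1) =
      if w.1 = deal b i then some b else none := by
    rw [← collect_replace_deal]
    congr 1
    funext j
    split_ifs <;> rfl
  simp only [functPC, hcollect]
  by_cases hw : w = (deal b i, n)
  · subst hw
    have hn : ∀ j, (if j = i then (deal b i, n) else (deal b j, n)).2 = n := by
      intro j; split_ifs <;> rfl
    simp only [if_true, hn, implies_true, ← Finset.sum_apply, hb, sum_val_bitsOf,
      randomShares_eq_map i]
    change PMF.bind _ _ = _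
    rw [PMF.bind_map]
    rfl
  · rw [if_neg hw]
    by_cases h1 : w.1 = deal b i
    · simp only [h1, if_true]
      rw [if_neg]
      intro h
      apply hw
      refine Prod.ext h1 ?_
      have h2 := (h i).trans (h (i + 1)).symm
      simpa using h2
    · simp only [h1, if_false]

theorem functReconst_eval (m : ℕ) (a : Party → RShare (ZMod m)) (x : Party → ZMod m) :
    (functReconst m).eval (fun j => a j + deal x j) =
      PMF.pure ((collect a).map fun v _ => ∑ j, (v j + x j)) := by
  simp only [functReconst]
  rw [collect_add_deal]
  cases collect a <;> rfl

theorem functWA_eval (m : ℕ) (i : Party) (a : Party → RShare (ZMod m)) :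
    (functWA m).eval a = match collect a with
      | some v => (PMF.uniformOfFintype (RShare (ZMod 2))).map fun z =>
          some (deal (sharingOf i z (wrap3 v)))
      | none => PMF.pure none := by
  simp only [functWA]
  cases collect a
  · rfl
  · simp only [randomShares_eq_map i]
    change PMF.bind _ _ = _
    rw [PMF.bind_map]
    rfl

theorem uniformOfFintype_prod {α β : Type} [Fintype α] [Nonempty α] [Fintype β] [Nonempty β] :
    PMF.uniformOfFintype (α × β) = (PMF.uniformOfFintype α).bind fun a =>
      (PMF.uniformOfFintype β).map fun b => (a, b) := by
  classical
  ext ⟨a, b⟩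
  rw [PMF.bind_apply, tsum_eq_single a, PMF.map_apply, tsum_eq_single b]
  · simp [ENNReal.mul_inv]
  · intro b' hb
    simp [hb.symm]
  · intro a' ha
    rw [PMF.map_apply, ENNReal.tsum_eq_zero.mpr, mul_zero]
    intro b₂
    simp [ha.symm]

/-- The joint sharing handed out by the correlated randomness functionality, from the shares `v` of
party `i` and the shared value `x`. -/
def prepShares {ℓ p : ℕ} (i : Party) (v : PrepShare ℓ p) (x : ZMod (2 ^ ℓ)) (j : Party) :
    PrepShare ℓ p :=
  (deal (sharingOf i v.1 x) j, deal (sharingOf i v.2.1 (bitsOf ℓ p x)) j,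
    deal (sharingOf i v.2.2 (wrap3 (sharingOf i v.1 x))) j)

theorem prepShares_self {ℓ p : ℕ} (i : Party) (v : PrepShare ℓ p) (x : ZMod (2 ^ ℓ)) :
    prepShares i v x i = v := by
  simp [prepShares, deal_sharingOf]

/-- The three pairs of party `i` are uniform whatever the secrets are, so they can be drawn before
`x`. -/
theorem functPrep_eval (ℓ p : ℕ) [NeZero p] (i : Party) (w : Party → Unit) :
    (functPrep ℓ p).eval w = (PMF.uniformOfFintype (PrepShare ℓ p)).bind fun v =>
      (PMF.uniformOfFintype (ZMod (2 ^ ℓ))).map fun x => some (prepShares i v x) := by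
  have h : (functPrep ℓ p).eval w = (PMF.uniformOfFintype (ZMod (2 ^ ℓ))).bind fun x =>
      (randomShares x).bind fun xs => (randomShares (bitsOf ℓ p x)).bind fun bs =>
        (randomShares (wrap3 xs)).bind fun αs =>
          PMF.pure (some fun j => (deal xs j, deal bs j, deal αs j)) := rfl
  rw [h, uniformOfFintype_prod, uniformOfFintype_prod (α := RShare (Fin ℓ → ZMod p))]
  simp only [randomShares_eq_map i, PMF.bind_map, PMF.bind_bind, Function.comp_def]
  simp only [PMF.map, Function.comp_def]
  rw [PMF.bind_comm]
  congr 1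
  funext u
  rw [PMF.bind_comm]
  congr 1
  funext b
  rw [PMF.bind_comm]
  rfl

/-! ### Indistinguishability, one call at a time. -/

section indistinguishability
variable {ι : Type} {F : ι → Functionality} {G : Functionality} {τ : Type} {i : Party}

/-- What `F c` answers when the honest parties are in the states `h` and the corrupted party
submits `q`. -/
noncomputable def realResponse {S : Type} (c : ι) (input : Party → S → (F c).In)
    (q : Option (F c).In) (h : {j : Party // j ≠ i} → Option S) :
    PMF (Option (Party → (F c).Out)) :=
  (F c).run fun j => if hj : j = i then q else (h ⟨j, hj⟩).map (input j)

/-- The simulated answer of `F c` to `q`, with the new states of the simulator and of `G`. -/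
noncomputable def idealResponse (Sim : Simulator F G τ) (x : {j : Party // j ≠ i} → G.In) (c : ι)
    (q : Option (F c).In) (y : τ × Option (Option (Party → G.Out))) :
    PMF (Option (F c).Out × τ × Option (Option (Party → G.Out))) :=
  (Sim.consult c y.1 q).bind fun e => (sessionOutcome x y.2 e.2).bind fun g =>
    (Sim.answer c e.1 (g.map fun r => r.map fun y => y i)).map fun o => (o.2, o.1, g)

/-- The honest states after the outcome `y.2` has been delivered, unless denied, to honest parties
in the states `y.1`. -/
def deliver {S O : Type} (d : Party → Bool)
    (y : ({j : Party // j ≠ i} → Option S) × Option (Party → O)) (j : {j : Party // j ≠ i}) :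
    Option (S × O) :=
  if d j then none else (y.1 j).bind fun st => y.2.map fun o => (st, o j)

/-- No adversary distinguishes the continuations of the real and of the ideal execution by `P`,
from random honest states and from a random state of the simulator and of `G`. -/
def Indistinguishable (Sim : Simulator F G τ) (x : {j : Party // j ≠ i} → G.In) {S : Type}
    (P : HybridProtocol F G.Out S) (R : PMF ({j : Party // j ≠ i} → Option S))
    (I : PMF (τ × Option (Option (Party → G.Out)))) : Prop :=
  ∀ (σ : Type) (A : Adversary F σ) (s : σ),
    R.bind (hybridExec i A P s) = I.bind fun y => idealExec i A Sim x P s y.1 y.2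

/-- The responses to `q` give the adversary the same view `view v`, `v` distributed as `W`, and
the executions remain indistinguishable for each value of `v`. -/
def IndistinguishableStep (Sim : Simulator F G τ) (x : {j : Party // j ≠ i} → G.In) {S : Type}
    (c : ι) (input : Party → S → (F c).In) (rest : HybridProtocol F G.Out (S × (F c).Out))
    (R : PMF ({j : Party // j ≠ i} → Option S)) (I : PMF (τ × Option (Option (Party → G.Out))))
    (q : Option (F c).In) : Prop :=
  ∃ (V : Type) (W : PMF V) (view : V → Option (F c).Out)
    (R' : V → PMF (({j : Party // j ≠ i} → Option S) × Option (Party → (F c).Out)))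
    (I' : V → PMF (τ × Option (Option (Party → G.Out)))),
    (R.bind fun h => (realResponse c input q h).map fun o => (o.map fun y => y i, h, o)) =
      (W.bind fun v => (R' v).map fun y => (view v, y)) ∧
    (I.bind fun y => idealResponse Sim x c q y) =
      (W.bind fun v => (I' v).map fun y => (view v, y)) ∧
    ∀ v d, Indistinguishable Sim x rest ((R' v).map (deliver d))
      ((I' v).bind fun y => (Sim.observe c y.1 d).map fun t => (t, y.2))

/-- The adversary's choices depend only on its own state and on the view, so they commute with the
drawing of the hidden data. -/
theorem Indistinguishable.call {Sim : Simulator F G τ} {x : {j : Party // j ≠ i} → G.In}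
    {S : Type} {c : ι} {input : Party → S → (F c).In}
    {rest : HybridProtocol F G.Out (S × (F c).Out)} {R : PMF ({j : Party // j ≠ i} → Option S)}
    {I : PMF (τ × Option (Option (Party → G.Out)))}
    (H : ∀ q, IndistinguishableStep Sim x c input rest R I q) :
    Indistinguishable Sim x (.call c input rest) R I := by
  intro σ A s
  have hl : R.bind (hybridExec i A (.call c input rest) s) =
      (A.submit c s).bind fun q =>
        (R.bind fun h => (realResponse c input q.2 h).map fun o =>
          (o.map fun y => y i, h, o)).bind fun w =>
            (A.receive c q.1 w.1).bind fun d => hybridExec i A rest d.1 (deliver d.2 w.2) := by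
    simp only [funext (hybridExec_call A c input rest s), PMF.bind_bind, PMF.bind_map]
    rw [PMF.bind_comm]
    rfl
  have hr : (I.bind fun y => idealExec i A Sim x (.call c input rest) s y.1 y.2) =
      (A.submit c s).bind fun q =>
        (I.bind fun y => idealResponse Sim x c q.2 y).bind fun w =>
          (A.receive c q.1 w.1).bind fun d => (Sim.observe c w.2.1 d.2).bind fun t =>
            idealExec i A Sim x rest d.1 t w.2.2 := by
    simp only [idealExec_call, idealResponse, PMF.bind_bind, PMF.bind_map]
    rw [PMF.bind_comm]
    rfl
  rw [hl, hr]
  congr 1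
  funext q
  obtain ⟨V, W, view, R', I', h1, h2, h3⟩ := H q.2
  rw [h1, h2]
  simp only [PMF.bind_bind, PMF.bind_map, Function.comp_def]
  congr 1
  funext v
  rw [PMF.bind_comm, PMF.bind_comm (I' v)]
  congr 1
  funext d
  have := h3 v d.2 σ A d.1
  simpa only [PMF.bind_bind, PMF.bind_map, Function.comp_def] using this

theorem Simulator.IsDead.indistinguishable {Sim : Simulator F G τ} {t : τ} (ht : Sim.IsDead t)
    (x : {j : Party // j ≠ i} → G.In) {S E : Type} (P : HybridProtocol F G.Out S) (I : PMF E)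
    (g : E → Option (Option (Party → G.Out))) :
    Indistinguishable Sim x P (PMF.pure fun _ => none) (I.map fun e => (t, g e)) := by
  intro σ A s
  rw [PMF.pure_bind, PMF.bind_map]
  simp only [Function.comp_def, idealExec_of_isDead A ht, PMF.bind_const]

theorem Simulator.IsDead.indistinguishable_call {Sim : Simulator F G τ} {t : τ}
    (ht : Sim.IsDead t) (x : {j : Party // j ≠ i} → G.In) {S D E : Type} (c : ι)
    (input : Party → S → (F c).In) (rest : HybridProtocol F G.Out (S × (F c).Out)) (R : PMF D)
    (h : D → {j : Party // j ≠ i} → Option S) (j : {j : Party // j ≠ i}) (hj : ∀ e, h e j = none)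
    (I : PMF E) (g : E → Option (Option (Party → G.Out))) :
    Indistinguishable Sim x (.call c input rest) (R.map h) (I.map fun e => (t, g e)) := by
  intro σ A s
  rw [← ht.indistinguishable x _ I g σ A s, PMF.pure_bind, PMF.bind_map]
  simp only [Function.comp_def, fun e => hybridExec_call_eq_none A c input rest s (h e) j (hj e),
    PMF.bind_const]

/-- After a rejection all honest parties have aborted and the view is constant; what the session of
`G` holds no longer matters. -/
theorem Simulator.IsDead.step_of_reject {Sim : Simulator F G τ} {t : τ} (ht : Sim.IsDead t)
    (x : {j : Party // j ≠ i} → G.In) {S E : Type} (c : ι) (input : Party → S → (F c).In)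
    (rest : HybridProtocol F G.Out (S × (F c).Out)) (R : PMF ({j : Party // j ≠ i} → Option S))
    (I : PMF (τ × Option (Option (Party → G.Out)))) (q : Option (F c).In)
    (hR : (R.bind fun h => (realResponse c input q h).map fun o => (h, o)) =
      R.map fun h => (h, none))
    (J : PMF E) (g : E → Option (Option (Party → G.Out)))
    (hI : I.bind (idealResponse Sim x c q) = J.map fun e => (none, t, g e)) :
    IndistinguishableStep Sim x c input rest R I q := by
  refine ⟨Unit, PMF.pure (), fun _ => none, fun _ => R.map fun h => (h, none),
    fun _ => J.map fun e => (t, g e), ?_, ?_, ?_⟩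
  · have := congrArg (PMF.map fun y => (y.2.map fun o => o i, y)) hR
    rw [PMF.map_bind] at this
    simp only [PMF.map_comp, Function.comp_def] at this
    rw [this, PMF.pure_bind, PMF.map_comp]
    rfl
  · rw [PMF.pure_bind, PMF.map_comp, hI]
    rfl
  · intro v d
    have h1 : ((R.map fun h => (h, (none : Option (Party → (F c).Out)))).map
        (deliver (i := i) d)) = PMF.pure fun _ => none := by
      rw [PMF.map_comp]
      have : deliver (i := i) d ∘ (fun h : {j : Party // j ≠ i} → Option S =>
          (h, (none : Option (Party → (F c).Out)))) = Function.const _ fun _ => none := by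
        funext h j
        simp [deliver]
      rw [this, PMF.map_const]
    have h2 : ((J.map fun e => (t, g e)).bind fun y =>
        (Sim.observe c y.1 d).map fun t => (t, y.2)) = J.map fun e => (t, g e) := by
      rw [PMF.bind_map]
      simp only [Function.comp_def, ht.observe, PMF.pure_map]
      rfl
    rw [h1, h2]
    exact ht.indistinguishable x rest J g

/-- A call which is accepted, followed by another call: it suffices to consider the adversaries
that deny no honest party its output. -/
theorem Simulator.IsDead.step_of_accept {Sim : Simulator F G τ} {t₀ : τ} (ht : Sim.IsDead t₀)
    (x : {j : Party // j ≠ i} → G.In) {S V D E : Type} (c c' : ι)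
    (input : Party → S → (F c).In) (input' : Party → S × (F c).Out → (F c').In)
    (rest : HybridProtocol F G.Out ((S × (F c).Out) × (F c').Out))
    (R : PMF ({j : Party // j ≠ i} → Option S)) (I : PMF (τ × Option (Option (Party → G.Out))))
    (q : Option (F c).In) (W : PMF V) (view : V → (F c).Out)
    (R' : PMF D) (st : V → D → {j : Party // j ≠ i} → S) (out : V → D → Party → (F c).Out)
    (I' : PMF E) (t : V → E → τ) (g : V → E → Option (Option (Party → G.Out)))
    (hview : ∀ v y, out v y i = view v)
    (hR : (R.bind fun h => (realResponse c input q h).map fun o => (h, o)) =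
      W.bind fun v => R'.map fun y => (fun j => some (st v y j), some (out v y)))
    (hI : I.bind (idealResponse Sim x c q) =
      W.bind fun v => I'.map fun e => (some (view v), t v e, g v e))
    (hobserve : ∀ v e d, (∃ j, j ≠ i ∧ d j = true) → Sim.observe c (t v e) d = PMF.pure t₀)
    (hobserve' : ∀ v e d, (¬ ∃ j, j ≠ i ∧ d j = true) → Sim.observe c (t v e) d = PMF.pure (t v e))
    (H : ∀ v, Indistinguishable Sim x (.call c' input' rest)
      (R'.map fun y j => some (st v y j, out v y j)) (I'.map fun e => (t v e, g v e))) :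
    IndistinguishableStep Sim x c input (.call c' input' rest) R I q := by
  refine ⟨V, W, fun v => some (view v),
    fun v => R'.map fun y => (fun j => some (st v y j), some (out v y)),
    fun v => I'.map fun e => (t v e, g v e), ?_, ?_, ?_⟩
  · have := congrArg (PMF.map fun y => (y.2.map fun o => o i, y)) hR
    rw [PMF.map_bind, PMF.map_bind] at this
    simp only [PMF.map_comp, Function.comp_def, Option.map_some, hview] at this
    simp only [this, PMF.map_comp, Function.comp_def]
  · simp only [PMF.map_comp, Function.comp_def]
    exact hI
  · intro v d
    rw [PMF.map_comp, PMF.bind_map]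
    by_cases hd : ∃ j, j ≠ i ∧ d j = true
    · simp only [Function.comp_def, hobserve v _ d hd, PMF.pure_map]
      obtain ⟨j, hj, hdj⟩ := hd
      exact ht.indistinguishable_call x c' input' rest R' _ ⟨j, hj⟩
        (fun e => by simp [deliver, hdj]) I' (g v)
    · simp only [Function.comp_def, hobserve' v _ d hd, PMF.pure_map]
      have hdel : (fun y => deliver (i := i) d
          (fun j => some (st v y j), some (out v y))) = fun y j => some (st v y j, out v y j) := by
        funext y j
        have : d j ≠ true := fun h => hd ⟨j, j.2, h⟩
        simp [deliver, this]
      rw [hdel]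
      exact H v

theorem Indistinguishable.ret {Sim : Simulator F G τ} {x : {j : Party // j ≠ i} → G.In}
    {S : Type} {out : Party → S → G.Out} {R : PMF ({j : Party // j ≠ i} → Option S)}
    {I : PMF (τ × Option (Option (Party → G.Out)))}
    (H : (R.map fun h j => (h j).map (out j)) = I.bind fun y =>
      (Sim.finish y.1).map fun d (j : {j : Party // j ≠ i}) =>
        if d j then none else y.2.join.map fun y => y j) :
    Indistinguishable Sim x (.ret out) R I := by
  intro σ A s
  have := congrArg (PMF.map fun y => (s, y)) H
  rw [PMF.map_comp, PMF.map_bind] at this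
  simp only [PMF.map_comp] at this
  exact this

end indistinguishability

/-! ### The three calls of the wrap protocol. -/

section stages
variable {ℓ p : ℕ} [Fact p.Prime] {i : Party}

theorem realResponse_none {S : Type} (c : WrapHybridIndex)
    (input : Party → S → (wrapHybrid ℓ p c).In) (h : {j : Party // j ≠ i} → Option S) :
    realResponse c input none h = PMF.pure none :=
  Functionality.run_eq_pure_none _ _ i (by simp)

theorem realResponse_some {ι : Type} {F : ι → Functionality} {S : Type} (c : ι)
    (input : Party → S → (F c).In) (w : (F c).In) (h : Party → S) :
    realResponse (i := i) c input (some w) (fun j => some (h j)) =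
      (F c).eval fun j => if j = i then w else input j (h j) := by
  rw [← Functionality.run_some, realResponse]
  congr 1
  funext j
  split_ifs <;> rfl

theorem idealResponse_none (c : WrapHybridIndex) (x : {j : Party // j ≠ i} → (functWA (2 ^ ℓ)).In)
    (y : WrapSimState ℓ p × Option (Option (Party → (functWA (2 ^ ℓ)).Out))) :
    idealResponse (wrapSimulator ℓ p i) x c none y = PMF.pure (none, .dead, y.2) := by
  have : (wrapSimulator ℓ p i).consult c y.1 none = PMF.pure (.dead, none) := by
    obtain ⟨t, g⟩ := y
    cases c <;> cases t <;> rfl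
  rw [idealResponse, this, PMF.pure_bind, sessionOutcome_none, PMF.pure_bind,
    (wrapSimulator_isDead ℓ p i).answer, PMF.pure_map]

theorem step_none {S : Type} (x : {j : Party // j ≠ i} → (functWA (2 ^ ℓ)).In)
    (c : WrapHybridIndex) (input : Party → S → (wrapHybrid ℓ p c).In)
    (rest : HybridProtocol (wrapHybrid ℓ p) (functWA (2 ^ ℓ)).Out (S × (wrapHybrid ℓ p c).Out))
    (R : PMF ({j : Party // j ≠ i} → Option S))
    (I : PMF (WrapSimState ℓ p × Option (Option (Party → (functWA (2 ^ ℓ)).Out)))) :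
    IndistinguishableStep (wrapSimulator ℓ p i) x c input rest R I none := by
  refine (wrapSimulator_isDead ℓ p i).step_of_reject x c input rest R I none ?_ I (fun y => y.2) ?_
  · simp only [realResponse_none, PMF.pure_map]
    rfl
  · simp only [funext (idealResponse_none (p := p) c x)]
    rfl

theorem comparisonStage_indistinguishable (x : {j : Party // j ≠ i} → (functWA (2 ^ ℓ)).In)
    (a : Party → ZMod (2 ^ ℓ)) (v : PrepShare ℓ p) (y r : ZMod (2 ^ ℓ))
    (hr : r = ∑ k, (a k + sharingOf i v.1 y k)) :
    Indistinguishable (wrapSimulator ℓ p i) x (comparisonStage ℓ p)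
      (PMF.pure fun j => some ((deal a j, prepShares i v y j), r))
      ((PMF.uniformOfFintype (RShare (ZMod 2))).map fun z =>
        (.opened v (deal a i) r z, some (some (deal (sharingOf i z (wrap3 a)))))) := by
  refine Indistinguishable.call fun q => ?_
  cases q with
  | none => exact step_none _ _ _ _ _ _
  | some w =>
    have hreal : realResponse (F := wrapHybrid ℓ p) (i := i) .pc
        (fun _ (s : (RShare (ZMod (2 ^ ℓ)) × PrepShare ℓ p) × ZMod (2 ^ ℓ)) =>
          (s.1.2.2.1, s.2.val + 1)) (some w)
        (fun j => some ((deal a j, prepShares i v y j), r)) = _ :=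
      (realResponse_some (F := wrapHybrid ℓ p) .pc _ w
        (fun j => ((deal a j, prepShares i v y j), r))).trans
      (functPC_eval ℓ p i y (sharingOf i v.2.1 (bitsOf ℓ p y)) (sum_sharingOf i _ _) (r.val + 1) w)
    rw [deal_sharingOf] at hreal
    by_cases hw : w = (v.2.1, r.val + 1)
    · replace hreal := hreal.trans (if_pos hw)
      have hideal : ∀ z, idealResponse (wrapSimulator ℓ p i) x .pc (some w)
          (.opened v (deal a i) r z, some (some (deal (sharingOf i z (wrap3 a))))) =
          PMF.pure (some (wrapOutput i (deal a i) v.1 v.2.2 r z),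
            .comparing (wrapOutput i (deal a i) v.1 v.2.2 r z),
            some (some (deal (sharingOf i z (wrap3 a))))) := by
        intro z
        have hc : (wrapSimulator ℓ p i).consult .pc (.opened v (deal a i) r z) (some w) =
            PMF.pure (.comparing (wrapOutput i (deal a i) v.1 v.2.2 r z), none) := if_pos hw
        rw [idealResponse, hc, PMF.pure_bind, sessionOutcome_none, PMF.pure_bind]
        exact PMF.pure_map _ _
      -- The view is the comparison pair `u`; given `u`, nothing random remains on either side, and
      -- the ideal output pair is the image of `u` under the last step.
      refine ⟨RShare (ZMod 2), PMF.uniformOfFintype _, some, fun u => PMF.pure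
        (fun j => some ((deal a j, prepShares i v y j), r),
          some (deal (sharingOf i u (if y.val ≥ r.val + 1 then 1 else 0)))),
        fun u => PMF.pure (.comparing u, some (some (deal
          (sharingOf i (wrapOutput i (deal a i) v.1 v.2.2 r u) (wrap3 a))))), ?_, ?_, ?_⟩
      · rw [PMF.pure_bind]
        refine (congrArg (PMF.map _) hreal).trans ((PMF.map_comp _ _ _).trans ?_)
        simp only [PMF.pure_map]
        refine congrArg (fun f => PMF.map f _) (funext fun u => ?_)
        exact Prod.ext (congrArg some (deal_sharingOf i u _)) rfl
      · rw [PMF.bind_map]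
        refine (congrArg (PMF.bind _) (funext hideal)).trans ?_
        -- Change of variables from the output pair `z`, drawn by the wrap functionality, to the
        -- comparison pair `u`.
        let e : RShare (ZMod 2) ≃ RShare (ZMod 2) := Function.Involutive.toPerm
          (wrapOutput i (deal a i) v.1 v.2.2 r) (wrapOutput_wrapOutput i _ _ _ _)
        refine Eq.trans ?_ (bind_uniformOfFintype_equiv e _)
        refine congrArg (PMF.bind _) (funext fun u => ?_)
        simp only [PMF.pure_map]
        exact (congrArg (fun z => PMF.pure (some (e u), WrapSimState.comparing (e u),
          some (some (deal (sharingOf i z (wrap3 a)))))) (wrapOutput_wrapOutput i _ _ _ _ _)).symm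
      · intro u d
        refine Indistinguishable.ret ?_
        rw [PMF.pure_map, PMF.pure_map, PMF.pure_bind]
        have hobs : (wrapSimulator ℓ p i).observe .pc (.comparing u) d =
          PMF.pure (.compared d) := rfl
        have hfin : (wrapSimulator ℓ p i).finish (.compared d) = PMF.pure d := rfl
        simp only [hobs, PMF.pure_map, PMF.pure_bind, hfin]
        refine congrArg PMF.pure (funext fun j => ?_)
        have hout := wrapOutput_sharingOf i j a (sharingOf i v.1 y) _
          (sum_sharingOf i v.2.2 (wrap3 (sharingOf i v.1 y)))
          (wrapOutput i (deal a i) v.1 v.2.2 r u) r hr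
        rw [deal_sharingOf, deal_sharingOf, wrapOutput_wrapOutput, sum_sharingOf] at hout
        simp only [deliver]
        cases d j with
        | true => rfl
        | false => exact congrArg some hout
    · replace hreal := hreal.trans (if_neg hw)
      have hideal : ∀ z, idealResponse (wrapSimulator ℓ p i) x .pc (some w)
          (.opened v (deal a i) r z, some (some (deal (sharingOf i z (wrap3 a))))) =
          PMF.pure (none, .dead, some (some (deal (sharingOf i z (wrap3 a))))) := by
        intro z
        have hc : (wrapSimulator ℓ p i).consult .pc (.opened v (deal a i) r z) (some w) =
            PMF.pure (.dead, none) := if_neg hw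
        rw [idealResponse, hc, PMF.pure_bind, sessionOutcome_none, PMF.pure_bind,
          (wrapSimulator_isDead ℓ p i).answer, PMF.pure_map]
        rfl
      refine (wrapSimulator_isDead ℓ p i).step_of_reject x _ _ _ _ _ _ ?_
        (PMF.uniformOfFintype (RShare (ZMod 2)))
        (fun z => some (some (deal (sharingOf i z (wrap3 a))))) ?_
      · rw [PMF.pure_bind, PMF.pure_map]
        exact (congrArg (PMF.map _) hreal).trans (PMF.pure_map _ _)
      · rw [PMF.bind_map]
        exact congrArg (PMF.bind _) (funext hideal)

theorem openingStage_indistinguishable (x : {j : Party // j ≠ i} → (functWA (2 ^ ℓ)).In)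
    (v : PrepShare ℓ p) :
    Indistinguishable (wrapSimulator ℓ p i) x (openingStage ℓ p)
      ((PMF.uniformOfFintype (ZMod (2 ^ ℓ))).map fun y j => some (x j, prepShares i v y j))
      (PMF.pure (.prepared v, none)) := by
  refine Indistinguishable.call fun q => ?_
  cases q with
  | none => exact step_none _ _ _ _ _ _
  | some w =>
    let w' : RShare (ZMod (2 ^ ℓ)) := w
    -- The effective inputs: those of the honest parties, and for party `i` its submission with the
    -- mask removed.
    obtain ⟨a', hai, hane⟩ : ∃ a' : Party → RShare (ZMod (2 ^ ℓ)),
        a' i = w' - v.1 ∧ ∀ j (hj : j ≠ i), a' j = x ⟨j, hj⟩ :=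
      ⟨fun j => if hj : j = i then w' - v.1 else x ⟨j, hj⟩, dif_pos rfl, fun j hj => dif_neg hj⟩
    have hreal : ∀ y, realResponse (F := wrapHybrid ℓ p) (i := i) (.reconst (2 ^ ℓ))
        (fun _ (s : RShare (ZMod (2 ^ ℓ)) × PrepShare ℓ p) => s.1 + s.2.1) (some w)
        (fun j => some (x j, prepShares i v y j)) =
        PMF.pure ((collect a').map fun b _ => ∑ j, (b j + sharingOf i v.1 y j)) := by
      intro y
      refine Eq.trans ?_ (functReconst_eval (2 ^ ℓ) a' (sharingOf i v.1 y))
      refine Eq.trans ?_ ((functReconst (2 ^ ℓ)).run_some _)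
      refine congrArg (Functionality.run _) (funext fun j => ?_)
      by_cases hj : j = i
      · subst hj
        rw [dif_pos rfl, deal_sharingOf, hai, sub_add_cancel]
        rfl
      · rw [dif_neg hj, hane j hj]
        rfl
    have hsession : sessionOutcome x none (some (some (w' - v.1))) =
        ((functWA (2 ^ ℓ)).eval a').map some := by
      refine congrArg (PMF.map some) ?_
      refine Eq.trans ?_ ((functWA (2 ^ ℓ)).run_some _)
      refine congrArg (Functionality.run _) (funext fun j => ?_)
      by_cases hj : j = i
      · subst hj
        rw [dif_pos rfl, hai]
      · rw [dif_neg hj, hane j hj]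
    rw [functWA_eval _ i] at hsession
    have hc : (wrapSimulator ℓ p i).consult (.reconst (2 ^ ℓ)) (.prepared v) (some w) =
        PMF.pure (.opening v (w' - v.1), some (some (w' - v.1))) := by
      refine congrArg (fun z : RShare (ZMod (2 ^ ℓ)) =>
        PMF.pure (WrapSimState.opening v z, some (some z))) ?_
      exact Prod.ext (congrArg (· - v.1.1) (ZMod.cast_id _ w'.1))
        (congrArg (· - v.1.2) (ZMod.cast_id _ w'.2))
    cases ha : collect a' with
    | none =>
      simp only [ha] at hreal hsession
      refine (wrapSimulator_isDead ℓ p i).step_of_reject x _ _ _ _ _ _ ?_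
        (PMF.pure ()) (fun _ => some none) ?_
      · rw [PMF.bind_map, PMF.map_comp]
        refine congrArg (PMF.bind _) (funext fun y => ?_)
        exact (congrArg (PMF.map _) (hreal y)).trans (PMF.pure_map _ _)
      · rw [PMF.pure_bind, PMF.pure_map, idealResponse]
        refine (congrArg (fun D => PMF.bind D _) hc).trans ((PMF.pure_bind _ _).trans ?_)
        refine (congrArg (fun D => PMF.bind D _) hsession).trans ?_
        rw [PMF.pure_map, PMF.pure_bind]
        exact PMF.pure_map _ _
    | some b =>
      simp only [ha] at hreal hsession
      have hb : ∀ j, a' j = deal b j := congrFun (eq_deal_of_collect ha)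
      have hx : ∀ j : {j : Party // j ≠ i}, x j = deal b j := fun j => by
        rw [← hb j, hane j j.2]
      have hi : w' - v.1 = deal b i := by
        rw [← hb i, hai]
      rw [hi] at hc hsession
      -- The view is a uniform `r`. Given `r`, the real mask is `r - ∑ k, b k`, while the ideal side
      -- still hides a uniform `z`.
      refine (wrapSimulator_isDead ℓ p i).step_of_accept x (.reconst (2 ^ ℓ)) _ _ _ _ _ _ (some w)
        (PMF.uniformOfFintype (ZMod (2 ^ ℓ))) id (PMF.pure ())
        (fun r _ j => (deal b j, prepShares i v (r - ∑ k, b k) j)) (fun r _ _ => r)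
        (PMF.uniformOfFintype (RShare (ZMod 2)))
        (fun r z => .opened v (deal b i) r z)
        (fun _ z => some (some (deal (sharingOf i z (wrap3 b)))))
        (fun _ _ => rfl) ?_ ?_ ?_ ?_ ?_
      · rw [PMF.bind_map]
        let e : ZMod (2 ^ ℓ) ≃ ZMod (2 ^ ℓ) := Equiv.addRight (∑ k, b k)
        refine Eq.trans ?_ (bind_uniformOfFintype_equiv e _)
        refine congrArg (PMF.bind _) (funext fun y => ?_)
        refine (congrArg (PMF.map _) (hreal y)).trans ((PMF.pure_map _ _).trans ?_)
        rw [PMF.pure_map]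
        refine congrArg PMF.pure (Prod.ext (funext fun j => ?_) ?_)
        · simp only [e, Equiv.coe_addRight, add_sub_cancel_right, hx]
        · refine congrArg some (funext fun _ => ?_)
          change ∑ j, (b j + sharingOf i v.1 y j) = y + ∑ k, b k
          rw [Finset.sum_add_distrib, sum_sharingOf, add_comm]
      · rw [PMF.pure_bind, idealResponse]
        refine (congrArg (fun D => PMF.bind D _) hc).trans ((PMF.pure_bind _ _).trans ?_)
        refine (congrArg (fun D => PMF.bind D _) hsession).trans ?_
        rw [PMF.map_comp, PMF.bind_map]
        -- The session draws `z` before the simulator draws `r`; they are independent, so the order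
        -- is exchanged.
        refine Eq.trans ?_ (PMF.bind_comm _ _ _)
        refine congrArg (PMF.bind _) (funext fun z => ?_)
        have hans : (wrapSimulator ℓ p i).answer (.reconst (2 ^ ℓ)) (.opening v (deal b i))
            (some (some (deal (sharingOf i z (wrap3 b)) i))) =
            (PMF.uniformOfFintype (ZMod (2 ^ ℓ))).map fun r =>
              (.opened v (deal b i) r z, some r) := by
          rw [deal_sharingOf]
          refine congrArg (fun f => PMF.map f _) (funext fun r => ?_)
          exact congrArg (fun r' : ZMod (2 ^ ℓ) => (WrapSimState.opened v (deal b i) r z, some r'))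
            (ZMod.cast_id _ r)
        exact (congrArg (PMF.map _) hans).trans (PMF.map_comp _ _ _)
      · intro r z d hd
        exact congrArg PMF.pure (if_pos hd)
      · intro r z d hd
        exact congrArg PMF.pure (if_neg hd)
      · intro r
        rw [PMF.pure_map]
        exact comparisonStage_indistinguishable x b v (r - ∑ k, b k) r
          (by rw [Finset.sum_add_distrib, sum_sharingOf]; ring)

theorem protocolWA_indistinguishable (x : {j : Party // j ≠ i} → (functWA (2 ^ ℓ)).In) :
    Indistinguishable (wrapSimulator ℓ p i) x (protocolWA ℓ p)
      (PMF.pure fun j => some (x j)) (PMF.pure (.start, none)) := by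
  rw [protocolWA_eq]
  refine Indistinguishable.call fun q => ?_
  cases q with
  | none => exact step_none _ _ _ _ _ _
  | some w =>
    -- The view is the pair data `v`; only the real side hides something, the uniform mask.
    refine (wrapSimulator_isDead ℓ p i).step_of_accept x .prep _ _ _ _ _ _ (some w)
      (PMF.uniformOfFintype (PrepShare ℓ p)) id (PMF.uniformOfFintype (ZMod (2 ^ ℓ)))
      (fun _ _ => x) (fun v y => prepShares i v y) (PMF.pure ()) (fun v _ => .prepared v)
      (fun _ _ => none) (fun v y => prepShares_self i v y) ?_ ?_ ?_ ?_ ?_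
    · rw [PMF.pure_bind]
      have hreal : realResponse (F := wrapHybrid ℓ p) (i := i) .prep
          (fun _ (_ : RShare (ZMod (2 ^ ℓ))) => ()) (some w) (fun j => some (x j)) = _ :=
        Eq.trans (congrArg (Functionality.run _) (funext fun j => by split_ifs <;> rfl))
          (((functPrep ℓ p).run_some fun _ => ()).trans (functPrep_eval ℓ p i _))
      refine (congrArg (PMF.map _) hreal).trans ?_
      refine (PMF.map_bind _ _ _).trans (congrArg (PMF.bind _) (funext fun v => ?_))
      exact PMF.map_comp _ _ _
    · rw [PMF.pure_bind]
      have hc : (wrapSimulator ℓ p i).consult .prep .start (some w) =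
        PMF.pure (.requested, none) := rfl
      rw [idealResponse, hc, PMF.pure_bind, sessionOutcome_none, PMF.pure_bind]
      simp only [PMF.pure_map]
      exact PMF.map_comp _ _ _
    · intro v _ d hd
      exact congrArg PMF.pure (if_pos hd)
    · intro v _ d hd
      exact congrArg PMF.pure (if_neg hd)
    · intro v
      rw [PMF.pure_map]
      exact openingStage_indistinguishable x v

end stages

theorem protocolWA_secure (ℓ p : ℕ) [Fact p.Prime] :
    SecurelyRealizesWithAbort (wrapHybrid ℓ p) (functWA (2 ^ ℓ)) (protocolWA ℓ p) := by
  intro i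
  refine ⟨WrapSimState ℓ p, wrapSimulator ℓ p i, fun σ A s x => ?_⟩
  simpa only [PMF.pure_bind] using! protocolWA_indistinguishable x σ A s

theorem theorem2 (ℓ p : ℕ) [Fact p.Prime] :
    SecurelyRealizesWithAbort (wrapHybrid ℓ p) (functWA (2 ^ ℓ)) (protocolWA ℓ p) ∧
    ∀ a x : Party → ZMod (2 ^ ℓ),
      (wrap3e a : ℤ) =
        (wrap2 (a 0) (x 0) : ℤ) + (wrap2 (a 1) (x 1) : ℤ) + (wrap2 (a 2) (x 2) : ℤ)
          + (wrap3e (fun j => a j + x j) : ℤ)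
          - (if (∑ j, x j).val ≥ (∑ j, (a j + x j)).val + 1 then (1 : ℤ) else 0)
          - (wrap3e x : ℤ) := by
  exact ⟨protocolWA_secure ℓ p, wrap3e_eq_of_mask⟩
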